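/- **Theorem 1.1.** Let $M$ be a nonempty finite-dimensional $C^\infty$ manifold that is Hausdorff, paracompact and without boundary, let $1\le r\le\infty$, and let $\mathrm{Diff}^r_c(M)_0$ be the group of $C^r$ diffeomorphisms of $M$ that can be joined to $\mathrm{id}_M$ by a compactly supported $C^r$ isotopy. Let $G\le \mathrm{Diff}^r_c(M)_0$ be a subgroup that is * *isotopically connected*: every $g\in G$ can be joined to $\mathrm{id}_M$ through a $C^r$ isotopy in $G$, that is, there is a $C^r$ map $\mathbb R\times M\to M$, $(t,x)\mapsto f_t(x)$, with $f_t\in G$ for all $t$, $f_0=\mathrm{id}_M$ and $f_1=g$; * *non-fixing*: $G(x)\ne\{x\}$ for every $x\in M$; * *factorizable*: for every open cover $\mathcal U$ of $M$, every $g\in G$ is a finite product $g=g_1\cdots g_k$ with $g_i\in G_{U_i}$ for some $U_i\in\mathcal U$, where $G_U$ is the identity component of the group of those elements of $G$ that have compact support contained in $U$ (the elements that can be joined to $\mathrm{id}_M$ through a $C^r$ isotopy in this group). Let $\mathcal F_{[G,G]}$ be the singular foliation determined by the commutator subgroup $[G,G]$; its leaves are the accessible sets of the set of all $C^r$-arrows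 obtained by restricting isotopies in $[G,G]$ starting at $\mathrm{id}_M$ to open subsets of $\mathbb R\times M$. Then $[G,G]$ is a simple group if and only if all leaves of $\mathcal F_{[G,G]}$ are dense in $M$. Call a set *minimal* if it is minimal under inclusion among the nonempty closed unions of leaves, and *proper* if it is not equal to $M$. If $[G,G]$ is simple, then $\mathcal F_{[G,G]}$ has no proper minimal set. If $M$ is compact, then $[G,G]$ is simple if and only if $\mathcal F_{[G,G]}$ has no proper minimal set. -/

import Mathlib

open scoped Manifold ContDiff

/-- The group of `C^n` diffeomorphisms of `M`, with composition as multiplication. -/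
instance Diffeomorph.instGroupSelf {𝕜 : Type*} [NontriviallyNormedField 𝕜]
    {E : Type*} [NormedAddCommGroup E] [NormedSpace 𝕜 E] {H : Type*} [TopologicalSpace H]
    {I : ModelWithCorners 𝕜 E H} {M : Type*} [TopologicalSpace M] [ChartedSpace H M]
    {n : WithTop ℕ∞} : Group (Diffeomorph I I M M n) where
  mul f g := g.trans f
  one := Diffeomorph.refl I M n
  inv f := f.symm
  mul_assoc _ _ _ := rfl
  one_mul _ := rfl
  mul_one _ := rfl
  inv_mul_cancel f := f.self_trans_symm

namespace DiffGroups

/-- `Diff^r(M)` for an `m`-dimensional manifold `M`. -/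
abbrev Diff (m : ℕ) (r : ℕ∞) (M : Type*) [TopologicalSpace M]
    [ChartedSpace (EuclideanSpace ℝ (Fin m)) M] : Type _ :=
  Diffeomorph (𝓡 m) (𝓡 m) M M (r : WithTop ℕ∞)

variable {m : ℕ} {r : ℕ∞} {M : Type*} [TopologicalSpace M]
  [ChartedSpace (EuclideanSpace ℝ (Fin m)) M]

/-- A `C^r` isotopy starting at the identity: a family `f t`, `t ∈ ℝ`, of diffeomorphisms such that
`(t, x) ↦ f t x` is of class `C^r` and `f 0 = id`. -/
def IsIsotopy (f : ℝ → Diff m r M) : Prop :=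
  ContMDiff (𝓘(ℝ, ℝ).prod (𝓡 m)) (𝓡 m) (r : WithTop ℕ∞) (fun p : ℝ × M => f p.1 p.2) ∧ f 0 = 1

/-- The diffeomorphisms that can be joined to the identity by a `C^r` isotopy all of whose members
lie in `S`. If `S` is a group of diffeomorphisms, this is its identity component. -/
def identityComponent (S : Set (Diff m r M)) : Set (Diff m r M) :=
  {g | ∃ f : ℝ → Diff m r M, IsIsotopy f ∧ (∀ t, f t ∈ S) ∧ f 1 = g}

/-- Every element of `G` is joined to the identity by a `C^r` isotopy in `G`. -/
def IsotopicallyConnected (G : Subgroup (Diff m r M)) : Prop :=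
  ∀ g ∈ G, g ∈ identityComponent (G : Set (Diff m r M))

variable (m r M) in
/-- `Diff^r_c(M)_0`: the diffeomorphisms that can be joined to the identity by a compactly supported
`C^r` isotopy, that is, one which from time `0` to time `1` moves no point outside some compact
set. -/
def diffCompactZero : Set (Diff m r M) :=
  {g | ∃ f : ℝ → Diff m r M, IsIsotopy f ∧ f 1 = g ∧
    ∃ K : Set M, IsCompact K ∧ ∀ t ∈ Set.Icc (0 : ℝ) 1, ∀ x, x ∉ K → f t x = x}

/-- The support of a diffeomorphism. -/
def supp (g : Diff m r M) : Set M := closure {x | g x ≠ x}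

/-- The elements of `G` that are compactly supported in `U`. -/
def supportedIn (G : Subgroup (Diff m r M)) (U : Set M) : Set (Diff m r M) :=
  {g | g ∈ G ∧ IsCompact (supp g) ∧ supp g ⊆ U}

/-- For every open cover, each element of `G` is a finite product of elements, each of which lies,
for some member `U` of the cover, in the identity component `G_U` of the group of those elements of
`G` that are compactly supported in `U`. -/
def Factorizable (G : Subgroup (Diff m r M)) : Prop :=
  ∀ 𝒰 : Set (Set M), (∀ U ∈ 𝒰, IsOpen U) → ⋃₀ 𝒰 = Set.univ →
    ∀ g ∈ G, ∃ l : List (Diff m r M), l.prod = g ∧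
      ∀ h ∈ l, ∃ U ∈ 𝒰, h ∈ identityComponent (supportedIn G U)

/-- `G(x) ≠ {x}` for every point `x`. -/
def NonFixing (G : Subgroup (Diff m r M)) : Prop :=
  ∀ x : M, ∃ g ∈ G, g x ≠ x

variable (m r M) in
/-- A `C^r`-arrow: a `C^r` map `φ` from an open subset of `ℝ × M` to `M` such that each `φ_t` is a
diffeomorphism between (possibly empty) open subsets of `M`, `φ_0` is the identity on its domain,
and `dom φ_t ⊆ dom φ_s` for `0 ≤ s < t`. -/
structure Arrow where
  dom : Set (ℝ × M)
  toFun : ℝ → M → M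
  isOpen_dom : IsOpen dom
  contMDiffOn : ContMDiffOn (𝓘(ℝ, ℝ).prod (𝓡 m)) (𝓡 m) (r : WithTop ℕ∞)
    (fun p : ℝ × M => toFun p.1 p.2) dom
  localDiffeo : ∀ t : ℝ, ∃ Φ : PartialDiffeomorph (𝓡 m) (𝓡 m) M M (r : WithTop ℕ∞),
    Φ.source = {x | (t, x) ∈ dom} ∧ ∀ x ∈ Φ.source, Φ.toFun x = toFun t x
  zero : ∀ x, ((0 : ℝ), x) ∈ dom → toFun 0 x = x
  antitone : ∀ s t : ℝ, 0 ≤ s → s < t → ∀ x, (t, x) ∈ dom → (s, x) ∈ dom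

/-- The accessibility relation of a set `A` of arrows: `y` is obtained from `x` by a finite
composition (possibly empty) of maps `φ_t` and `(φ_t)⁻¹` with `φ ∈ A`. Its classes are the
accessible sets of `A`, which are the leaves of the singular foliation defined by `A`. -/
def accessibility (A : Set (Arrow m r M)) : Setoid M :=
  Relation.EqvGen.setoid fun x y => ∃ φ ∈ A, ∃ t : ℝ, (t, x) ∈ φ.dom ∧ φ.toFun t x = y

/-- The arrows which are restrictions of isotopies in `G` to open subsets of `ℝ × M`. -/
def arrowsOf (G : Subgroup (Diff m r M)) : Set (Arrow m r M) :=
  {φ | ∃ f : ℝ → Diff m r M, IsIsotopy f ∧ (∀ t, f t ∈ G) ∧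
    ∀ p ∈ φ.dom, φ.toFun p.1 p.2 = f p.1 p.2}

/-- The singular foliation `F_G` determined by `G`, as the partition of `M` into leaves. -/
def foliation (G : Subgroup (Diff m r M)) : Setoid M := accessibility (arrowsOf G)

/-- All leaves (classes) of the partition are dense. -/
def AllLeavesDense (F : Setoid M) : Prop := ∀ L ∈ F.classes, Dense L

/-- A saturated set is a union of leaves. -/
def IsSaturated (F : Setoid M) (S : Set M) : Prop := ∃ C ⊆ F.classes, S = ⋃₀ C

/-- A minimal set is a minimal element, for inclusion, among the nonempty closed saturated sets. -/
def IsMinimalSet (F : Setoid M) (S : Set M) : Prop :=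
  Minimal (fun T : Set M => T.Nonempty ∧ IsClosed T ∧ IsSaturated F T) S

/-- There is no minimal set other than `M` itself. -/
def NoProperMinimalSet (F : Setoid M) : Prop :=
  ∀ S : Set M, IsMinimalSet F S → S = Set.univ

end DiffGroups

/-! The criterion is purely about actions: smoothness enters only through factorizability and the
description of leaves. Let `Γ` act faithfully by homeomorphisms on a paracompact Hausdorff space,
fragmentably and without global fixed points, let `D` be its commutator subgroup and `N` a
nontrivial normal subgroup of `D`.

Some `n ∈ N` displaces an open set `V` from itself. For `g`, `h` supported in a small `U ⊆ V`,
suitable `k`, `l` supported in `V` give `⁅g, h⁆ = ⁅a, b⁆` with `a = ⁅g, k⁆` and `b = ⁅h, l⁆` in `D`;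
then `⁅a, b⁆ = ⁅⁅a, n⁆, b⁆ ∈ N` (`exists_open_commutator_mem`). If the orbits of `D` are dense,
conjugation by `D` spreads this to a neighbourhood of every point, and fragmentation yields `D ≤ N`
(`commutator_le_of_local`). Conversely, the pointwise fixer in `D` of a non-dense orbit closure is a
proper nontrivial normal subgroup.

The leaves for `⁅G, G⁆` are its orbits, because commutators of isotopies are isotopies in `⁅G, G⁆`;
this needs inverses of isotopies to be `C^r` (`contMDiff_inv_family`). Dense leaves exclude proper
minimal sets, and on a compact space Zorn's lemma gives the converse. -/

namespace FragmentedAction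

open Set
open scoped commutatorElement

/-! ### Star refinements of open covers. -/

section Covers

variable {X : Type*} [TopologicalSpace X]

/-- Every open cover of a paracompact Hausdorff space has a strong star refinement. -/
theorem exists_star_refinement [T2Space X] [ParacompactSpace X] (𝒱 : Set (Set X))
    (ho : ∀ V ∈ 𝒱, IsOpen V) (hc : ⋃₀ 𝒱 = univ) :
    ∃ 𝒰 : Set (Set X), (∀ U ∈ 𝒰, IsOpen U) ∧ ⋃₀ 𝒰 = univ ∧
      ∀ A ∈ 𝒰, ∀ B ∈ 𝒰, (A ∩ B).Nonempty → ∃ V ∈ 𝒱, A ∪ B ⊆ V := by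
  obtain ⟨u, uo, uc, ulf, us⟩ := precise_refinement (fun V : 𝒱 => (V : Set X))
    (fun V => ho V V.2) (by rw [← sUnion_eq_iUnion, hc])
  obtain ⟨F, Fc, Fcl, Fu⟩ := exists_iUnion_eq_closed_subset uo (fun x => ulf.point_finite x) uc
  have Flf : LocallyFinite F := ulf.subset Fu
  -- Local finiteness of the shrinking `F` makes `W x` open: a finite intersection minus a locally
  -- finite union of closed sets.
  let W : X → Set X := fun x => (⋂ i ∈ {i | x ∈ F i}, u i) ∩ (⋃ i ∈ {i | x ∉ F i}, F i)ᶜ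
  have Wo : ∀ x, IsOpen (W x) := by
    intro x
    refine IsOpen.inter ((Flf.point_finite x).isOpen_biInter fun i _ => uo i) ?_
    rw [isOpen_compl_iff, biUnion_eq_iUnion]
    exact (Flf.comp_injective Subtype.val_injective).isClosed_iUnion fun i => Fcl i
  have Wx : ∀ x, x ∈ W x := by
    intro x
    refine ⟨mem_iInter₂.2 fun i hi => Fu i hi, fun h => ?_⟩
    obtain ⟨i, hi, hx⟩ := mem_iUnion₂.1 h
    exact hi hx
  -- The index `i` depends only on `y`, so one `u i` contains every `W x` through `y`.
  have key : ∀ x y i, y ∈ W x → y ∈ F i → W x ⊆ u i := by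
    intro x y i hy hi z hz
    have hxi : x ∈ F i := by
      by_contra h
      exact hy.2 (mem_iUnion₂.2 ⟨i, h, hi⟩)
    exact mem_iInter₂.1 hz.1 i hxi
  refine ⟨range W, ?_, ?_, ?_⟩
  · rintro _ ⟨x, rfl⟩
    exact Wo x
  · exact eq_univ_of_forall fun x => ⟨W x, mem_range_self x, Wx x⟩
  · rintro _ ⟨a, rfl⟩ _ ⟨b, rfl⟩ ⟨y, hya, hyb⟩
    obtain ⟨i, hi⟩ := mem_iUnion.1 (Fc.symm ▸ mem_univ y : y ∈ ⋃ i, F i)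
    exact ⟨i, i.2, (union_subset (key a y i hya hi) (key b y i hyb hi)).trans (us i)⟩

/-- Refining twice suffices: the sets covering `A ∪ B` and `B ∪ C` share a point of `B`. -/
theorem exists_chain_refinement [T2Space X] [ParacompactSpace X] (𝒱 : Set (Set X))
    (ho : ∀ V ∈ 𝒱, IsOpen V) (hc : ⋃₀ 𝒱 = univ) :
    ∃ 𝒰 : Set (Set X), (∀ U ∈ 𝒰, IsOpen U) ∧ ⋃₀ 𝒰 = univ ∧
      ∀ A ∈ 𝒰, ∀ B ∈ 𝒰, ∀ C ∈ 𝒰, (A ∩ B).Nonempty → (B ∩ C).Nonempty →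
        ∃ V ∈ 𝒱, A ∪ B ∪ C ⊆ V := by
  obtain ⟨𝒲, Wo, Wc, hW⟩ := exists_star_refinement 𝒱 ho hc
  obtain ⟨𝒰, Uo, Uc, hU⟩ := exists_star_refinement 𝒲 Wo Wc
  refine ⟨𝒰, Uo, Uc, fun A hA B hB C hC hAB hBC => ?_⟩
  obtain ⟨S, hS, hABS⟩ := hU A hA B hB hAB
  obtain ⟨T, hT, hBCT⟩ := hU B hB C hC hBC
  obtain ⟨b, hb⟩ := hAB
  obtain ⟨V, hV, hSTV⟩ := hW S hS T hT ⟨b, hABS (Or.inr hb.2), hBCT (Or.inl hb.2)⟩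
  exact ⟨V, hV, union_subset (hABS.trans (subset_union_left.trans hSTV))
    (subset_union_right.trans (hBCT.trans (subset_union_right.trans hSTV)))⟩

end Covers

/-! ### Supports and commutators in group actions. -/

variable {Γ X : Type*} [Group Γ] [MulAction Γ X]

variable (Γ) in
/-- The elements which move no point outside `U`. -/
def rigidStabilizer (U : Set X) : Subgroup Γ := fixingSubgroup Γ Uᶜ

theorem mem_rigidStabilizer {U : Set X} {g : Γ} :
    g ∈ rigidStabilizer Γ U ↔ ∀ x, x ∉ U → g • x = x :=
  mem_fixingSubgroup_iff Γ

theorem rigidStabilizer_mono {U V : Set X} (h : U ⊆ V) :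
    rigidStabilizer Γ U ≤ rigidStabilizer Γ V :=
  fun _ hg => mem_rigidStabilizer.2 fun x hx => mem_rigidStabilizer.1 hg x fun hU => hx (h hU)

theorem smul_mem_of_mem_rigidStabilizer {U : Set X} {g : Γ} (hg : g ∈ rigidStabilizer Γ U)
    {x : X} (hx : x ∈ U) : g • x ∈ U := by
  by_contra h
  have := mem_rigidStabilizer.1 hg _ h
  exact h ((smul_left_cancel g this).symm ▸ hx)

theorem conj_mem_rigidStabilizer {U V : Set X} {g k : Γ} (hg : g ∈ rigidStabilizer Γ U)
    (h : ∀ x ∈ U, k • x ∈ V) : k * g * k⁻¹ ∈ rigidStabilizer Γ V := by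
  refine mem_rigidStabilizer.2 fun x hx => ?_
  have : k⁻¹ • x ∉ U := fun hU => hx (by simpa using h _ hU)
  rw [mul_smul, mul_smul, mem_rigidStabilizer.1 hg _ this, smul_inv_smul]

theorem commute_of_disjoint [FaithfulSMul Γ X] {U V : Set X} (hUV : ∀ x ∈ U, x ∉ V) {g h : Γ}
    (hg : g ∈ rigidStabilizer Γ U) (hh : h ∈ rigidStabilizer Γ V) : Commute g h := by
  refine FaithfulSMul.eq_of_smul_eq_smul (α := X) fun x => ?_
  rw [mul_smul, mul_smul]
  by_cases hx : x ∈ U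
  · rw [mem_rigidStabilizer.1 hh _ (hUV x hx),
      mem_rigidStabilizer.1 hh _ (hUV _ (smul_mem_of_mem_rigidStabilizer hg hx))]
  · rw [mem_rigidStabilizer.1 hg _ hx]
    by_cases hV : x ∈ V
    · exact mem_rigidStabilizer.1 hg _ fun h' =>
        hUV _ h' (smul_mem_of_mem_rigidStabilizer hh hV)
    · rw [mem_rigidStabilizer.1 hh _ hV, mem_rigidStabilizer.1 hg _ hx]

theorem bracket_mem_commutator (g h : Γ) : ⁅g, h⁆ ∈ commutator Γ :=
  Subgroup.commutator_mem_commutator (Subgroup.mem_top _) (Subgroup.mem_top _)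

/-- Both products `a * c * (b * d)` and `b * d * (a * c)` release the same factor `c * d` on the
right, which cancels. -/
theorem commutator_mul_mul_eq {a b c d : Γ} (hcd : Commute c d) (had : Commute a d)
    (hcb : Commute c b) :
    ⁅a * c, b * d⁆ = ⁅a, b⁆ := by
  have h1 : a * c * (b * d) = a * b * (c * d) := by
    simp only [mul_assoc]; rw [← mul_assoc c b, hcb.eq, mul_assoc]
  have h2 : b * d * (a * c) = b * a * (c * d) := by
    simp only [mul_assoc]; rw [← mul_assoc d a, ← had.eq, mul_assoc, hcd.eq]
  rw [commutatorElement_def, commutatorElement_def]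
  have h3 : a * c * (b * d) * (a * c)⁻¹ * (b * d)⁻¹ =
      (a * c * (b * d)) * (b * d * (a * c))⁻¹ := by group
  rw [h3, h1, h2]; group

variable [TopologicalSpace X]

variable (Γ X) in
/-- For every open cover, the group is generated by elements supported in its members. -/
def Fragmentable : Prop :=
  ∀ 𝒰 : Set (Set X), (∀ U ∈ 𝒰, IsOpen U) → ⋃₀ 𝒰 = univ →
    Subgroup.closure {g : Γ | ∃ U ∈ 𝒰, g ∈ rigidStabilizer Γ U} = ⊤

variable (Γ X) in
/-- No point is fixed by the whole group. -/
def MovesAllPoints : Prop := ∀ x : X, ∃ g : Γ, g • x ≠ x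

/-! ### Fragmentable actions and simplicity of the commutator subgroup. -/

variable [T2Space X]

/-- Otherwise every fragment for the cover `{U, {x}ᶜ}` fixes `x`, hence so does `Γ`. -/
theorem exists_mem_rigidStabilizer_smul_ne (hfrag : Fragmentable Γ X)
    (hmove : MovesAllPoints Γ X) {U : Set X} (hU : IsOpen U) {x : X} (hx : x ∈ U) :
    ∃ g ∈ rigidStabilizer Γ U, g • x ≠ x := by
  by_contra! H
  obtain ⟨g, hg⟩ := hmove x
  have h := hfrag {U, {x}ᶜ} (by rintro V (rfl | rfl); exacts [hU, isOpen_compl_singleton])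
    (by
      refine eq_univ_of_forall fun y => ?_
      by_cases hy : y = x
      · exact ⟨U, by simp, hy ▸ hx⟩
      · exact ⟨{x}ᶜ, by simp, hy⟩)
  have hle : Subgroup.closure {g : Γ | ∃ V ∈ ({U, {x}ᶜ} : Set (Set X)), g ∈ rigidStabilizer Γ V}
      ≤ MulAction.stabilizer Γ x := by
    rw [Subgroup.closure_le]
    rintro k ⟨V, (rfl | rfl), hk⟩
    · exact H k hk
    · exact mem_rigidStabilizer.1 hk x (by simp)
  rw [h] at hle
  exact hg (hle (Subgroup.mem_top g))

/-- With `h` moving `x` and `g` moving `x` but fixing `h⁻¹ • x`, the commutator `⁅g, h⁆` acts on `x`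
as `g` does. -/
theorem exists_commutator_smul_ne (hfrag : Fragmentable Γ X)
    (hmove : MovesAllPoints Γ X) {U : Set X} (hU : IsOpen U) {x : X} (hx : x ∈ U) :
    ∃ g ∈ commutator Γ, g ∈ rigidStabilizer Γ U ∧ g • x ≠ x := by
  obtain ⟨h, hh, hhx⟩ := exists_mem_rigidStabilizer_smul_ne hfrag hmove hU hx
  have hne : x ≠ h⁻¹ • x := fun e => hhx (by rw [eq_inv_smul_iff] at e; exact e)
  obtain ⟨g, hg, hgx⟩ := exists_mem_rigidStabilizer_smul_ne hfrag hmove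
    (hU.inter (isOpen_compl_singleton (x := h⁻¹ • x))) (x := x) ⟨hx, hne⟩
  have hgU := rigidStabilizer_mono inter_subset_left hg
  refine ⟨⁅g, h⁆, bracket_mem_commutator _ _, ?_, ?_⟩
  · rw [commutatorElement_def]
    exact mul_mem (mul_mem (mul_mem hgU hh) (inv_mem hgU)) (inv_mem hh)
  · rw [commutatorElement_def, mul_smul, mul_smul,
      mem_rigidStabilizer.1 (inv_mem hg) _ (by simp), ← mul_smul,
      mul_assoc, mul_inv_cancel, mul_one]
    exact hgx

/-- If all commutators of elements with small common support lie in `N`, and `N` is normalized by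
the commutator subgroup, then `N` contains the commutator subgroup. -/
theorem commutator_le_of_local [FaithfulSMul Γ X] [ParacompactSpace X] (hfrag : Fragmentable Γ X)
    {N : Subgroup Γ} (hN : ∀ d ∈ commutator Γ, ∀ n ∈ N, d * n * d⁻¹ ∈ N)
    (hloc : ∀ x : X, ∃ U, IsOpen U ∧ x ∈ U ∧ (∃ k : Γ, ∀ y ∈ U, k • y ∉ U) ∧
      ∀ g ∈ rigidStabilizer Γ U, ∀ h ∈ rigidStabilizer Γ U, ⁅g, h⁆ ∈ N) :
    commutator Γ ≤ N := by
  obtain ⟨𝒰, Uo, Uc, hU⟩ := exists_chain_refinement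
    {U : Set X | IsOpen U ∧ (∃ k : Γ, ∀ y ∈ U, k • y ∉ U) ∧
      ∀ g ∈ rigidStabilizer Γ U, ∀ h ∈ rigidStabilizer Γ U, ⁅g, h⁆ ∈ N}
    (fun V hV => hV.1)
    (eq_univ_of_forall fun x => by
      obtain ⟨U, h1, h2, h3⟩ := hloc x
      exact ⟨U, ⟨h1, h3⟩, h2⟩)
  have hgen := hfrag 𝒰 Uo Uc
  set S := {g : Γ | ∃ U ∈ 𝒰, g ∈ rigidStabilizer Γ U}
  have hS : ∀ a ∈ S, ∀ b ∈ S, ∀ g : Γ, g * ⁅a, b⁆ * g⁻¹ ∈ N := by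
    rintro a ⟨A, hA, ha⟩ b ⟨B, hB, hb⟩
    by_cases hAB : (A ∩ B).Nonempty
    swap
    · intro g
      have : Commute a b := commute_of_disjoint (fun x hxA hxB => hAB ⟨x, hxA, hxB⟩) ha hb
      rw [commutatorElement_eq_one_iff_commute.2 this]
      simp
    have hz : ⁅a, b⁆ ∈ N := by
      obtain ⟨W, ⟨-, -, hW⟩, hsub⟩ := hU A hA B hB B hB hAB (hAB.mono fun x hx => ⟨hx.2, hx.2⟩)
      exact hW a (rigidStabilizer_mono (subset_union_left.trans (subset_union_left.trans hsub)) ha)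
        b (rigidStabilizer_mono (subset_union_right.trans hsub) hb)
    have hzU : ⁅a, b⁆ ∈ rigidStabilizer Γ (A ∪ B) := by
      have ha' := rigidStabilizer_mono (V := A ∪ B) subset_union_left ha
      have hb' := rigidStabilizer_mono (V := A ∪ B) subset_union_right hb
      rw [commutatorElement_def]
      exact mul_mem (mul_mem (mul_mem ha' hb') (inv_mem ha')) (inv_mem hb')
    -- `N` is normalized only by the commutator subgroup. Modulo the centralizer of `⁅a, b⁆` this is
    -- enough to reach all conjugates under `Γ`.
    have hall : (⊤ : Subgroup Γ) ≤ commutator Γ ⊔ Subgroup.centralizer {⁅a, b⁆} := by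
      rw [← hgen, Subgroup.closure_le]
      rintro c ⟨C, hC, hc⟩
      suffices h : ∃ k : Γ, k * c * k⁻¹ ∈ Subgroup.centralizer {⁅a, b⁆} by
        obtain ⟨k, hk⟩ := h
        have : c = ⁅c, k⁆ * (k * c * k⁻¹) := by rw [commutatorElement_def]; group
        rw [this]
        exact Subgroup.mul_mem_sup (bracket_mem_commutator _ _) hk
      -- When `C` meets `A ∪ B` the three sets form a chain, so one `k` displaces their union and
      -- carries the support of `c` off `A ∪ B`.
      have hchain : ((A ∪ B) ∩ C).Nonempty → ∃ k : Γ, ∀ y ∈ A ∪ B ∪ C, k • y ∉ A ∪ B ∪ C := by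
        rintro ⟨x, hx | hx, hxC⟩
        · obtain ⟨W, ⟨-, ⟨k, hk⟩, -⟩, hsub⟩ := hU B hB A hA C hC
            (by rwa [inter_comm]) ⟨x, hx, hxC⟩
          rw [union_comm B A] at hsub
          exact ⟨k, fun y hy h => hk y (hsub hy) (hsub h)⟩
        · obtain ⟨W, ⟨-, ⟨k, hk⟩, -⟩, hsub⟩ := hU A hA B hB C hC hAB ⟨x, hx, hxC⟩
          exact ⟨k, fun y hy h => hk y (hsub hy) (hsub h)⟩
      by_cases hmeet : ((A ∪ B) ∩ C).Nonempty
      · obtain ⟨k, hk⟩ := hchain hmeet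
        refine ⟨k, Subgroup.mem_centralizer_singleton_iff.2 ?_⟩
        have hkc : k * c * k⁻¹ ∈ rigidStabilizer Γ (A ∪ B)ᶜ :=
          conj_mem_rigidStabilizer hc fun y hy h => hk y (Or.inr hy) (Or.inl h)
        exact (commute_of_disjoint (U := (A ∪ B)ᶜ) (fun x hx hx' => hx hx') hkc hzU).eq
      · refine ⟨1, Subgroup.mem_centralizer_singleton_iff.2 ?_⟩
        rw [one_mul, inv_one, mul_one]
        exact (commute_of_disjoint (fun x hx hx' => hmeet ⟨x, hx', hx⟩) hc hzU).eq
    intro g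
    obtain ⟨d, hd, e, he, rfl⟩ := Subgroup.mem_sup_of_normal_left.1 (hall (Subgroup.mem_top g))
    have he' : e * ⁅a, b⁆ = ⁅a, b⁆ * e := Subgroup.mem_centralizer_singleton_iff.1 he
    have : d * e * ⁅a, b⁆ * (d * e)⁻¹ = d * ⁅a, b⁆ * d⁻¹ := by
      rw [mul_assoc d e, he']; group
    rw [this]
    exact hN d hd _ hz
  have hPN : Subgroup.normalClosure {z : Γ | ∃ a ∈ S, ∃ b ∈ S, ⁅a, b⁆ = z} ≤ N := by
    rw [Subgroup.normalClosure, Subgroup.closure_le]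
    intro z hz
    obtain ⟨w, ⟨a, ha, b, hb, rfl⟩, hconj⟩ := Group.mem_conjugatesOfSet_iff.1 hz
    obtain ⟨g, rfl⟩ := isConj_iff.1 hconj
    exact hS a ha b hb g
  refine le_trans ?_ hPN
  -- `Γ ⧸ P` is generated by the pairwise commuting images of `S`, hence abelian.
  set P := Subgroup.normalClosure {z : Γ | ∃ a ∈ S, ∃ b ∈ S, ⁅a, b⁆ = z}
  have hcomm : ∀ a ∈ S, ∀ b ∈ S, Commute (a : Γ ⧸ P) (b : Γ ⧸ P) := by
    intro a ha b hb
    rw [← commutatorElement_eq_one_iff_commute]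
    exact (QuotientGroup.eq_one_iff (N := P) ⁅a, b⁆).2
      (Subgroup.subset_normalClosure ⟨a, ha, b, hb, rfl⟩)
  have step : ∀ a ∈ S, ∀ h : Γ, Commute (a : Γ ⧸ P) (h : Γ ⧸ P) := by
    intro a ha h
    have hle : (⊤ : Subgroup Γ) ≤
        (Subgroup.centralizer {(a : Γ ⧸ P)}).comap (QuotientGroup.mk' P) := by
      rw [← hgen, Subgroup.closure_le]
      exact fun b hb => Subgroup.mem_centralizer_singleton_iff.2 (hcomm b hb a ha).eq
    exact (Subgroup.mem_centralizer_singleton_iff.1 (hle (Subgroup.mem_top h))).symm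
  rw [commutator_def, Subgroup.commutator_le]
  intro g _ h _
  have hle : (⊤ : Subgroup Γ) ≤
      (Subgroup.centralizer {(h : Γ ⧸ P)}).comap (QuotientGroup.mk' P) := by
    rw [← hgen, Subgroup.closure_le]
    exact fun a ha => Subgroup.mem_centralizer_singleton_iff.2 (step a ha h).eq
  have : Commute (g : Γ ⧸ P) (h : Γ ⧸ P) :=
    Subgroup.mem_centralizer_singleton_iff.1 (hle (Subgroup.mem_top g))
  exact (QuotientGroup.eq_one_iff (N := P) ⁅g, h⁆).1 (commutatorElement_eq_one_iff_commute.2 this)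

variable [ContinuousConstSMul Γ X]

theorem exists_open_disjoint_image (g : Γ) {V : Set X} (hV : IsOpen V) {x : X} (hx : x ∈ V)
    (hg : g • x ≠ x) : ∃ U ⊆ V, IsOpen U ∧ x ∈ U ∧ ∀ y ∈ U, g • y ∉ U := by
  obtain ⟨A, B, hA, hB, hxA, hxB, hAB⟩ := t2_separation hg.symm
  refine ⟨V ∩ (A ∩ (g • ·) ⁻¹' B), inter_subset_left,
    hV.inter (hA.inter (hB.preimage (continuous_const_smul g))), ⟨hx, hxA, hxB⟩, ?_⟩
  rintro y ⟨-, -, hy⟩ ⟨-, hy', -⟩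
  exact disjoint_left.1 hAB hy' hy

variable [FaithfulSMul Γ X]

/-- Near a point of an open set which is displaced by `n`, commutators of elements with small
support are obtained from `n` by taking commutators with elements of the commutator subgroup. -/
theorem exists_open_commutator_mem (hfrag : Fragmentable Γ X) (hmove : MovesAllPoints Γ X)
    {N : Subgroup Γ} (hN : ∀ d ∈ commutator Γ, ∀ n ∈ N, d * n * d⁻¹ ∈ N) {n : Γ} (hn : n ∈ N)
    {V : Set X} (hV : IsOpen V) (hnV : ∀ y ∈ V, n • y ∉ V) {x : X} (hx : x ∈ V) :
    ∃ U, IsOpen U ∧ x ∈ U ∧ (∃ k : Γ, ∀ y ∈ U, k • y ∉ U) ∧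
      ∀ g ∈ rigidStabilizer Γ U, ∀ h ∈ rigidStabilizer Γ U, ⁅g, h⁆ ∈ N := by
  -- The points `x`, `k • x`, `l • x` are distinct, as `l` is supported off `k • x`. Hence a small
  -- `U` around `x` has `U`, `k • U`, `l • U` pairwise disjoint.
  obtain ⟨k, hk, hkx⟩ := exists_mem_rigidStabilizer_smul_ne hfrag hmove hV hx
  obtain ⟨l, hl, hlx⟩ := exists_mem_rigidStabilizer_smul_ne hfrag hmove
    (hV.inter (isOpen_compl_singleton (x := k • x))) (x := x) ⟨hx, hkx.symm⟩
  have hlV := rigidStabilizer_mono inter_subset_left hl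
  have hlk : (k⁻¹ * l) • x ≠ x := fun e => by
    rw [mul_smul, inv_smul_eq_iff] at e
    exact (smul_mem_of_mem_rigidStabilizer hl ⟨hx, hkx.symm⟩).2 e
  obtain ⟨U₁, hU₁V, hU₁, hx₁, hd₁⟩ := exists_open_disjoint_image k hV hx hkx
  obtain ⟨U₂, hU₂V, hU₂, hx₂, hd₂⟩ := exists_open_disjoint_image l hU₁ hx₁ hlx
  obtain ⟨U, hUV, hU, hxU, hd⟩ := exists_open_disjoint_image (k⁻¹ * l) hU₂ hx₂ hlk
  have hdk : ∀ y ∈ U, k • y ∉ U := fun y hy h => hd₁ y (hU₂V (hUV hy)) (hU₂V (hUV h))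
  have hdl : ∀ y ∈ U, l • y ∉ U := fun y hy h => hd₂ y (hUV hy) (hUV h)
  have hUV : U ⊆ V := hUV.trans (hU₂V.trans hU₁V)
  refine ⟨U, hU, hxU, ⟨k, hdk⟩, fun g hg h hh => ?_⟩
  have hgV := rigidStabilizer_mono hUV hg
  have hhV := rigidStabilizer_mono hUV hh
  have hgk : k * g⁻¹ * k⁻¹ ∈ rigidStabilizer Γ ((k • ·) '' U) :=
    conj_mem_rigidStabilizer (inv_mem hg) fun y hy => mem_image_of_mem _ hy
  have hhl : l * h⁻¹ * l⁻¹ ∈ rigidStabilizer Γ ((l • ·) '' U) :=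
    conj_mem_rigidStabilizer (inv_mem hh) fun y hy => mem_image_of_mem _ hy
  have dk : ∀ y ∈ (k • ·) '' U, y ∉ U := by rintro _ ⟨y, hy, rfl⟩; exact hdk y hy
  have dl : ∀ y ∈ (l • ·) '' U, y ∉ U := by rintro _ ⟨y, hy, rfl⟩; exact hdl y hy
  have dkl : ∀ y ∈ (k • ·) '' U, y ∉ (l • ·) '' U := by
    rintro _ ⟨y, hy, rfl⟩ ⟨z, hz, hzy⟩
    have hzy : l • z = k • y := hzy
    refine hd z hz ?_
    rw [mul_smul, hzy, inv_smul_smul]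
    exact hy
  have e₁ : ⁅⁅g, k⁆, ⁅h, l⁆⁆ = ⁅g, h⁆ := by
    have eg : ⁅g, k⁆ = g * (k * g⁻¹ * k⁻¹) := by rw [commutatorElement_def]; group
    have eh : ⁅h, l⁆ = h * (l * h⁻¹ * l⁻¹) := by rw [commutatorElement_def]; group
    rw [eg, eh]
    exact commutator_mul_mul_eq (commute_of_disjoint dkl hgk hhl)
      (commute_of_disjoint dl hhl hg).symm (commute_of_disjoint dk hgk hh)
  have hg'V : ⁅g, k⁆ ∈ rigidStabilizer Γ V := by
    rw [commutatorElement_def]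
    exact mul_mem (mul_mem (mul_mem hgV hk) (inv_mem hgV)) (inv_mem hk)
  have hh'V : ⁅h, l⁆ ∈ rigidStabilizer Γ V := by
    rw [commutatorElement_def]
    exact mul_mem (mul_mem (mul_mem hhV hlV) (inv_mem hhV)) (inv_mem hlV)
  have hg'D : ⁅g, k⁆ ∈ commutator Γ := bracket_mem_commutator _ _
  have hh'D : ⁅h, l⁆ ∈ commutator Γ := bracket_mem_commutator _ _
  rw [← e₁]
  -- From here on it matters only that `a` and `b` are supported in `V` and lie in the commutator
  -- subgroup, which normalizes `N`.
  generalize ⁅g, k⁆ = a at *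
  generalize ⁅h, l⁆ = b at *
  have ha : n * a⁻¹ * n⁻¹ ∈ rigidStabilizer Γ ((n • ·) '' V) :=
    conj_mem_rigidStabilizer (inv_mem hg'V) fun y hy => mem_image_of_mem _ hy
  have dn : ∀ y ∈ (n • ·) '' V, y ∉ V := by rintro _ ⟨y, hy, rfl⟩; exact hnV y hy
  have e₂ : ⁅⁅a, n⁆, b⁆ = ⁅a, b⁆ := by
    have ea : ⁅a, n⁆ = a * (n * a⁻¹ * n⁻¹) := by rw [commutatorElement_def]; group
    have := commutator_mul_mul_eq (a := a) (b := b) (d := 1) (Commute.one_right _)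
      (Commute.one_right _) (commute_of_disjoint dn ha hh'V)
    rwa [mul_one, ← ea] at this
  rw [← e₂]
  have hanN : ⁅a, n⁆ ∈ N := by
    rw [commutatorElement_def]
    exact mul_mem (hN a hg'D n hn) (inv_mem hn)
  have : ⁅⁅a, n⁆, b⁆ = ⁅a, n⁆ * (b * ⁅a, n⁆⁻¹ * b⁻¹) := by
    rw [commutatorElement_def ⁅a, n⁆]; group
  rw [this]
  exact mul_mem hanN (hN b hh'D _ (inv_mem hanN))

/-- A nontrivial `n ∈ N` displaces some open `V`, and every orbit of the commutator subgroup enters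
`V`; conjugating back transports the local statement from `V` to any point. -/
theorem commutator_le_of_dense [ParacompactSpace X] (hfrag : Fragmentable Γ X)
    (hmove : MovesAllPoints Γ X) (hdense : ∀ x : X, Dense {y | ∃ d ∈ commutator Γ, d • x = y})
    {N : Subgroup Γ} (hN : ∀ d ∈ commutator Γ, ∀ n ∈ N, d * n * d⁻¹ ∈ N) (hN1 : N ≠ ⊥) :
    commutator Γ ≤ N := by
  obtain ⟨⟨n, hn⟩, hn1'⟩ := Subgroup.ne_bot_iff_exists_ne_one.1 hN1
  have hn1 : n ≠ 1 := fun e => hn1' (Subtype.ext e)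
  obtain ⟨p, hp⟩ : ∃ p : X, n • p ≠ p := by
    by_contra! H
    exact hn1 (FaithfulSMul.eq_of_smul_eq_smul (α := X) fun x => by rw [H, one_smul])
  obtain ⟨V, -, hV, hpV, hnV⟩ := exists_open_disjoint_image n isOpen_univ (mem_univ p) hp
  refine commutator_le_of_local hfrag hN fun x => ?_
  obtain ⟨_, hyV, d, hd, rfl⟩ := (hdense x).inter_open_nonempty V hV ⟨p, hpV⟩
  obtain ⟨U, hU, hxU, ⟨k, hk⟩, hUN⟩ := exists_open_commutator_mem hfrag hmove hN hn hV hnV hyV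
  refine ⟨(d • ·) ⁻¹' U, hU.preimage (continuous_const_smul d), hxU,
    ⟨d⁻¹ * k * d, fun y hy h => hk (d • y) hy ?_⟩, fun g hg h hh => ?_⟩
  · have h : d • (d⁻¹ * k * d) • y ∈ U := h
    rwa [← mul_smul, ← mul_assoc, ← mul_assoc, mul_inv_cancel, one_mul, mul_smul] at h
  · have := hN d⁻¹ (inv_mem hd) _ (hUN _ (conj_mem_rigidStabilizer hg fun y hy => hy)
      _ (conj_mem_rigidStabilizer (k := d) hh fun y hy => hy))
    rw [← conjugate_commutatorElement] at this
    simpa [mul_assoc] using this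

/-- For a fragmentable group moving all points, the commutator subgroup is simple if and only if
all of its orbits are dense. -/
theorem isSimpleGroup_commutator_iff [ParacompactSpace X] [Nonempty X]
    (hfrag : Fragmentable Γ X) (hmove : MovesAllPoints Γ X) :
    IsSimpleGroup (commutator Γ) ↔ ∀ x : X, Dense {y | ∃ d ∈ commutator Γ, d • x = y} := by
  constructor
  · intro hs x
    by_contra hnd
    set K := closure {y | ∃ d ∈ commutator Γ, d • x = y}
    have hK : ∀ d ∈ commutator Γ, ∀ y ∈ K, d • y ∈ K := by
      intro d hd
      refine fun y hy => map_mem_closure (continuous_const_smul d) hy ?_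
      rintro _ ⟨e, he, rfl⟩
      exact ⟨d * e, mul_mem hd he, mul_smul d e x⟩
    obtain ⟨z, hz⟩ : ∃ z, z ∉ K := by
      by_contra! H
      exact hnd H
    -- Normal because `K` is invariant, nontrivial because some commutator element is supported off
    -- `K` and moves `z`, proper because `x ∈ K` is moved.
    let N : Subgroup (commutator Γ) := (fixingSubgroup Γ K).subgroupOf (commutator Γ)
    have hmem : ∀ g : commutator Γ, g ∈ N ↔ ∀ y ∈ K, (g : Γ) • y = y := fun g => by
      rw [Subgroup.mem_subgroupOf, mem_fixingSubgroup_iff]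
    have hN : N.Normal := by
      refine ⟨fun n hn g => (hmem _).2 fun y hy => ?_⟩
      have := (hmem n).1 hn _ (hK _ (inv_mem g.2) y hy)
      simp only [Subgroup.coe_mul, Subgroup.coe_inv, mul_smul] at this ⊢
      rw [this, smul_inv_smul]
    rcases hN.eq_bot_or_eq_top with h | h
    · obtain ⟨g, hgD, hg, hgz⟩ := exists_commutator_smul_ne hfrag hmove
        (isClosed_closure (s := {y | ∃ d ∈ commutator Γ, d • x = y})).isOpen_compl hz
      have : (⟨g, hgD⟩ : commutator Γ) ∈ N :=
        (hmem _).2 fun y hy => mem_rigidStabilizer.1 hg y (not_not.2 hy)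
      rw [h, Subgroup.mem_bot] at this
      exact hgz (by rw [show g = 1 from congrArg Subtype.val this, one_smul])
    · obtain ⟨g, hgD, -, hgx⟩ := exists_commutator_smul_ne hfrag hmove isOpen_univ (mem_univ x)
      have : (⟨g, hgD⟩ : commutator Γ) ∈ N := h ▸ Subgroup.mem_top _
      exact hgx ((hmem _).1 this x (subset_closure ⟨1, one_mem _, one_smul Γ x⟩))
  · intro hdense
    obtain ⟨x⟩ := ‹Nonempty X›
    obtain ⟨g, hgD, -, hgx⟩ := exists_commutator_smul_ne hfrag hmove isOpen_univ (mem_univ x)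
    have : Nontrivial (commutator Γ) := ⟨⟨g, hgD⟩, 1, fun e => hgx (by
      rw [show g = 1 from congrArg Subtype.val e, one_smul])⟩
    refine ⟨fun H hH => or_iff_not_imp_left.2 fun hbot => ?_⟩
    have := commutator_le_of_dense hfrag hmove hdense (N := H.map (commutator Γ).subtype) (by
      rintro d hd _ ⟨n, hn, rfl⟩
      exact ⟨_, hH.conj_mem n hn ⟨d, hd⟩, rfl⟩)
      (by rwa [ne_eq, Subgroup.map_eq_bot_iff_of_injective _ (Subgroup.subtype_injective _)])
    refine eq_top_iff.2 fun d _ => ?_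
    obtain ⟨e, he, hed⟩ := this d.2
    rwa [← Subtype.ext hed]

end FragmentedAction

/-! ### Isotopies: smooth inverses and commutators. -/

section

open Set Filter Topology

/-- A `C^n` family of maps which contains the identity has, locally, a `C^n` family of
right inverses. -/
theorem ContDiffAt.exists_eventually_right_inverse_of_family {E : Type*} [NormedAddCommGroup E]
    [NormedSpace ℝ E] [CompleteSpace E] {n : WithTop ℕ∞} (hn : n ≠ 0) {P : ℝ × E → E} {t : ℝ}
    {u : E} (hP : ContDiffAt ℝ n P (t, u)) (hid : ∀ᶠ v in 𝓝 u, P (t, v) = v) :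
    ∃ Q : ℝ × E → E, ContDiffAt ℝ n Q (t, u) ∧ Q (t, u) = u ∧
      ∀ᶠ q in 𝓝 (t, u), P (q.1, Q q) = q.2 := by
  -- The inverse function theorem applies to `F`: its derivative is the shear `(s, v) ↦ (s, v + L
  -- (s, 0))`, since `P (t, ·)` is the identity near `u`.
  let F : ℝ × E → ℝ × E := fun p => (p.1, P p)
  have hF : ContDiffAt ℝ n F (t, u) := contDiffAt_fst.prodMk hP
  have hFtu : F (t, u) = (t, u) := Prod.ext rfl hid.self_of_nhds
  have hPd : HasFDerivAt P (fderiv ℝ P (t, u)) (t, u) :=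
    (hP.differentiableAt hn).hasFDerivAt
  set L := fderiv ℝ P (t, u)
  have hLv : ∀ v : E, L (0, v) = v := by
    have h1 : HasFDerivAt (fun v => P (t, v)) (L.comp (.inr ℝ ℝ E)) u :=
      HasFDerivAt.comp u hPd (hasFDerivAt_prodMk_right t u)
    have h2 : HasFDerivAt (fun v => P (t, v)) (.id ℝ E) u :=
      (hasFDerivAt_id u).congr_of_eventuallyEq hid
    intro v
    simpa using DFunLike.congr_fun (h1.unique h2) v
  let e : (ℝ × E) ≃L[ℝ] (ℝ × E) := ContinuousLinearEquiv.skewProd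
    (ContinuousLinearEquiv.refl ℝ ℝ) (ContinuousLinearEquiv.refl ℝ E) (L.comp (.inl ℝ ℝ E))
  have he : HasFDerivAt F (e : (ℝ × E) →L[ℝ] (ℝ × E)) (t, u) := by
    refine (hasFDerivAt_fst.prodMk hPd).congr_fderiv ?_
    refine ContinuousLinearMap.ext fun ⟨s, v⟩ => Prod.ext rfl ?_
    change L (s, v) = v + L (s, 0)
    conv_rhs => rw [← hLv v, ← map_add]
    simp
  let Q : ℝ × E → ℝ × E := hF.localInverse he hn
  have hQ : ContDiffAt ℝ n Q (t, u) := by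
    have := hF.to_localInverse he hn
    rwa [hFtu] at this
  have hQtu : Q (t, u) = (t, u) := by
    have := hF.localInverse_apply_image he hn
    rwa [hFtu] at this
  have hinv : ∀ᶠ q in 𝓝 (t, u), F (Q q) = q := by
    have := (hF.hasStrictFDerivAt' he hn).eventually_right_inverse
    rwa [hFtu] at this
  refine ⟨fun q => (Q q).2, hQ.snd, congrArg Prod.snd hQtu, hinv.mono fun q hq => ?_⟩
  have h1 : (Q q).1 = q.1 := (Prod.ext_iff.1 hq).1
  have h2 : P (Q q) = q.2 := (Prod.ext_iff.1 hq).2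
  rwa [← h1]

namespace DiffGroups

variable {m : ℕ} {r : ℕ∞} {M : Type*} [TopologicalSpace M]
  [ChartedSpace (EuclideanSpace ℝ (Fin m)) M]

theorem inv_apply_self (f : Diff m r M) (x : M) : f⁻¹ (f x) = x := f.symm_apply_apply x

theorem apply_inv_self (f : Diff m r M) (x : M) : f (f⁻¹ x) = x := f.apply_symm_apply x

theorem contMDiff_inv_family [IsManifold (𝓡 m) ∞ M] (hr : 1 ≤ r) {f : ℝ → Diff m r M}
    (hf : ContMDiff (𝓘(ℝ, ℝ).prod (𝓡 m)) (𝓡 m) (r : WithTop ℕ∞)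
      (fun p : ℝ × M => f p.1 p.2)) :
    ContMDiff (𝓘(ℝ, ℝ).prod (𝓡 m)) (𝓡 m) (r : WithTop ℕ∞)
      (fun p : ℝ × M => (f p.1)⁻¹ p.2) := by
  have : IsManifold (𝓡 m) (r : WithTop ℕ∞) M :=
    IsManifold.of_le (n := ∞) (by exact_mod_cast le_top)
  have hr0 : (r : WithTop ℕ∞) ≠ 0 := by
    have : r ≠ 0 := (lt_of_lt_of_le one_pos hr).ne'
    exact_mod_cast this
  rintro ⟨t, y⟩
  set x := (f t)⁻¹ y
  let φ := extChartAt (𝓡 m) x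
  have hφt : φ.target ∈ 𝓝 (φ x) := extChartAt_target_mem_nhds x
  have hφs : φ.source ∈ 𝓝 x := extChartAt_source_mem_nhds x
  have hφx : φ.symm (φ x) = x := extChartAt_to_inv x
  -- Composing with `(f t)⁻¹` makes the family the identity at time `t`, so a single chart at `x`
  -- serves for source and target.
  let h : ℝ × M → M := fun p => (f t)⁻¹ (f p.1 p.2)
  have hh : ContMDiff (𝓘(ℝ, ℝ).prod (𝓡 m)) (𝓡 m) (r : WithTop ℕ∞) h :=
    ((f t)⁻¹).contMDiff.comp hf
  have hhx : h (t, x) = x := inv_apply_self _ _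
  have hsymm : ContMDiffAt 𝓘(ℝ, EuclideanSpace ℝ (Fin m)) (𝓡 m) (r : WithTop ℕ∞) φ.symm (φ x) :=
    (contMDiffOn_extChartAt_symm x).contMDiffAt hφt
  have hpair : ContMDiffAt (𝓘(ℝ, ℝ).prod 𝓘(ℝ, EuclideanSpace ℝ (Fin m)))
      (𝓘(ℝ, ℝ).prod (𝓡 m)) (r : WithTop ℕ∞)
      (fun q : ℝ × EuclideanSpace ℝ (Fin m) => (q.1, φ.symm q.2)) (t, φ x) :=
    contMDiffAt_fst.prodMk (ContMDiffAt.comp (t, φ x) hsymm contMDiffAt_snd)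
  have hhφ : ContMDiffAt (𝓘(ℝ, ℝ).prod 𝓘(ℝ, EuclideanSpace ℝ (Fin m))) (𝓡 m) (r : WithTop ℕ∞)
      (fun q : ℝ × EuclideanSpace ℝ (Fin m) => h (q.1, φ.symm q.2)) (t, φ x) :=
    ContMDiffAt.comp (t, φ x) (g := h) hh.contMDiffAt hpair
  have hhφx : h (t, φ.symm (φ x)) = x := by rw [hφx, hhx]
  let P : ℝ × EuclideanSpace ℝ (Fin m) → EuclideanSpace ℝ (Fin m) :=
    fun q => φ (h (q.1, φ.symm q.2))
  have hP : ContDiffAt ℝ r P (t, φ x) := by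
    have hφ : ContMDiffAt (𝓡 m) 𝓘(ℝ, EuclideanSpace ℝ (Fin m)) (r : WithTop ℕ∞) φ
        (h (t, φ.symm (φ x))) := by
      rw [hhφx]
      exact contMDiffAt_extChartAt
    have hP : ContMDiffAt (𝓘(ℝ, ℝ).prod 𝓘(ℝ, EuclideanSpace ℝ (Fin m)))
        𝓘(ℝ, EuclideanSpace ℝ (Fin m)) (r : WithTop ℕ∞) P (t, φ x) :=
      ContMDiffAt.comp (t, φ x) hφ hhφ
    rw [← contMDiffAt_iff_contDiffAt]
    rwa [modelWithCornersSelf_prod, ← chartedSpaceSelf_prod]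
  have hid : ∀ᶠ v in 𝓝 (φ x), P (t, v) = v := by
    filter_upwards [hφt] with v hv
    change φ ((f t)⁻¹ (f t (φ.symm v))) = v
    rw [inv_apply_self, φ.right_inv hv]
  obtain ⟨Q, hQ, hQx, hPQ⟩ := hP.exists_eventually_right_inverse_of_family hr0 hid
  have hg : ContMDiffAt (𝓘(ℝ, ℝ).prod (𝓡 m)) (𝓘(ℝ, ℝ).prod 𝓘(ℝ, EuclideanSpace ℝ (Fin m)))
      (r : WithTop ℕ∞) (fun p : ℝ × M => (p.1, φ ((f t)⁻¹ p.2))) (t, y) :=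
    contMDiffAt_fst.prodMk (ContMDiffAt.comp (t, y) (g := fun z => φ ((f t)⁻¹ z))
      (ContMDiffAt.comp y contMDiffAt_extChartAt ((f t)⁻¹).contMDiff.contMDiffAt) contMDiffAt_snd)
  have hQm : ContMDiffAt (𝓘(ℝ, ℝ).prod 𝓘(ℝ, EuclideanSpace ℝ (Fin m)))
      𝓘(ℝ, EuclideanSpace ℝ (Fin m)) (r : WithTop ℕ∞) Q (t, φ x) := by
    have := contMDiffAt_iff_contDiffAt.2 hQ
    rwa [modelWithCornersSelf_prod, ← chartedSpaceSelf_prod] at this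
  have hQg : ContMDiffAt (𝓘(ℝ, ℝ).prod (𝓡 m)) 𝓘(ℝ, EuclideanSpace ℝ (Fin m))
      (r : WithTop ℕ∞) (fun p : ℝ × M => Q (p.1, φ ((f t)⁻¹ p.2))) (t, y) :=
    ContMDiffAt.comp (t, y) hQm hg
  have hres : ContMDiffAt (𝓘(ℝ, ℝ).prod (𝓡 m)) (𝓡 m)
      (r : WithTop ℕ∞) (fun p : ℝ × M => φ.symm (Q (p.1, φ ((f t)⁻¹ p.2)))) (t, y) := by
    refine ContMDiffAt.comp (t, y) ?_ hQg
    change ContMDiffAt _ _ _ φ.symm (Q (t, φ x))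
    rwa [hQx]
  refine hres.congr_of_eventuallyEq ?_
  -- The right inverse is only known after applying `φ`; injectivity of `φ` needs both points in its
  -- source.
  have hclose : ∀ᶠ p : ℝ × M in 𝓝 (t, y),
      h (p.1, φ.symm (Q (p.1, φ ((f t)⁻¹ p.2)))) ∈ φ.source := by
    have : ContinuousAt (fun p : ℝ × M => h (p.1, φ.symm (Q (p.1, φ ((f t)⁻¹ p.2))))) (t, y) :=
      (hh.continuous.continuousAt).comp (continuousAt_fst.prodMk hres.continuousAt)
    refine this.eventually_mem ?_
    change φ.source ∈ 𝓝 (h (t, φ.symm (Q (t, φ x))))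
    rwa [hQx, hhφx]
  have hsrc : ∀ᶠ p : ℝ × M in 𝓝 (t, y), (f t)⁻¹ p.2 ∈ φ.source :=
    (((f t)⁻¹).continuous.continuousAt.comp continuousAt_snd).eventually_mem hφs
  filter_upwards [hclose, hsrc, hg.continuousAt.eventually hPQ] with p h1 h2 h3
  have h4 : h (p.1, φ.symm (Q (p.1, φ ((f t)⁻¹ p.2)))) = (f t)⁻¹ p.2 := φ.injOn h1 h2 h3
  have h5 : f p.1 (φ.symm (Q (p.1, φ ((f t)⁻¹ p.2)))) = p.2 := ((f t)⁻¹).injective h4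
  change (f p.1)⁻¹ p.2 = _
  rw [← inv_apply_self (f p.1) (φ.symm _), h5]

theorem IsIsotopy.mul {f g : ℝ → Diff m r M} (hf : IsIsotopy f) (hg : IsIsotopy g) :
    IsIsotopy fun t => f t * g t :=
  ⟨hf.1.comp (contMDiff_fst.prodMk hg.1), by simp only [hf.2, hg.2, mul_one]⟩

theorem IsIsotopy.inv [IsManifold (𝓡 m) ∞ M] (hr : 1 ≤ r) {f : ℝ → Diff m r M}
    (hf : IsIsotopy f) : IsIsotopy fun t => (f t)⁻¹ :=
  ⟨contMDiff_inv_family hr hf.1, by simp only [hf.2, inv_one]⟩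

theorem isIsotopy_one : IsIsotopy fun _ : ℝ => (1 : Diff m r M) :=
  ⟨contMDiff_snd, rfl⟩

/-- The identity component of a group of diffeomorphisms is a group. -/
def identityComponentSubgroup [IsManifold (𝓡 m) ∞ M] (hr : 1 ≤ r) (G : Subgroup (Diff m r M)) :
    Subgroup (Diff m r M) where
  carrier := identityComponent (G : Set (Diff m r M))
  mul_mem' := by
    rintro _ _ ⟨f, hf, hfG, rfl⟩ ⟨g, hg, hgG, rfl⟩
    exact ⟨_, hf.mul hg, fun t => mul_mem (hfG t) (hgG t), rfl⟩
  one_mem' := ⟨_, isIsotopy_one, fun _ => one_mem G, rfl⟩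
  inv_mem' := by
    rintro _ ⟨f, hf, hfG, rfl⟩
    exact ⟨_, hf.inv hr, fun t => inv_mem (hfG t), rfl⟩

/-- The commutator subgroup of an isotopically connected group is isotopically connected. -/
theorem IsotopicallyConnected.commutator [IsManifold (𝓡 m) ∞ M] (hr : 1 ≤ r)
    {G : Subgroup (Diff m r M)} (hG : IsotopicallyConnected G) : IsotopicallyConnected ⁅G, G⁆ := by
  suffices h : ⁅G, G⁆ ≤ identityComponentSubgroup hr ⁅G, G⁆ from fun g hg => h hg
  rw [Subgroup.commutator_le]
  intro a ha b hb
  obtain ⟨f, hf, hfG, rfl⟩ := hG a ha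
  obtain ⟨g, hg, hgG, rfl⟩ := hG b hb
  exact ⟨_, ((hf.mul hg).mul (hf.inv hr)).mul (hg.inv hr),
    fun t => Subgroup.commutator_mem_commutator (hfG t) (hgG t), rfl⟩

/-- The arrow defined by an isotopy. -/
noncomputable def IsIsotopy.toArrow {f : ℝ → Diff m r M} (hf : IsIsotopy f) : Arrow m r M where
  dom := univ
  toFun t x := f t x
  isOpen_dom := isOpen_univ
  contMDiffOn := hf.1.contMDiffOn
  localDiffeo t := ⟨(f t).toPartialDiffeomorph, rfl, fun _ _ => rfl⟩
  zero x _ := by rw [hf.2]; rfl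
  antitone _ _ _ _ _ _ := mem_univ _

/-- The leaves of the foliation of an isotopically connected group are its orbits. -/
theorem foliation_iff_of_isotopicallyConnected {G : Subgroup (Diff m r M)}
    (hG : IsotopicallyConnected G) {x y : M} : foliation G x y ↔ ∃ g ∈ G, g x = y := by
  constructor
  · intro h
    induction h with
    | rel x y h =>
      obtain ⟨φ, ⟨f, -, hfG, hφ⟩, t, hx, rfl⟩ := h
      exact ⟨f t, hfG t, (hφ _ hx).symm⟩
    | refl x => exact ⟨1, one_mem G, rfl⟩
    | symm x y _ ih =>
      obtain ⟨g, hg, rfl⟩ := ih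
      exact ⟨g⁻¹, inv_mem hg, inv_apply_self g x⟩
    | trans x y z _ _ ih₁ ih₂ =>
      obtain ⟨g, hg, rfl⟩ := ih₁
      obtain ⟨h, hh, rfl⟩ := ih₂
      exact ⟨h * g, mul_mem hh hg, rfl⟩
  · rintro ⟨g, hg, rfl⟩
    obtain ⟨f, hf, hfG, rfl⟩ := hG g hg
    exact Relation.EqvGen.rel _ _
      ⟨hf.toArrow, ⟨f, hf, hfG, fun _ _ => rfl⟩, 1, mem_univ _, rfl⟩

/-! ### Saturated sets, dense leaves and minimal sets. -/

section Leaves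

variable {X : Type*}

theorem isSaturated_iff {F : Setoid X} {S : Set X} :
    IsSaturated F S ↔ ∀ x y, F x y → x ∈ S → y ∈ S := by
  constructor
  · rintro ⟨C, hC, rfl⟩ x y hxy ⟨L, hL, hx⟩
    obtain ⟨z, rfl⟩ := hC hL
    exact ⟨_, hL, F.trans (F.symm hxy) hx⟩
  · intro h
    refine ⟨{L | L ∈ F.classes ∧ L ⊆ S}, fun L hL => hL.1, ?_⟩
    refine Subset.antisymm (fun x hx => ?_) (sUnion_subset fun L hL => hL.2)
    exact ⟨{y | F y x}, ⟨F.mem_classes x, fun y hy => h x y (F.symm hy) hx⟩, F.refl x⟩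

variable [TopologicalSpace X]

theorem allLeavesDense_iff {F : Setoid X} : AllLeavesDense F ↔ ∀ x, Dense {y | F x y} := by
  have hset : ∀ x, {y | F x y} = {y | F y x} := fun x => ext fun y => ⟨F.symm, F.symm⟩
  constructor
  · intro h x
    rw [hset]
    exact h _ (F.mem_classes x)
  · rintro h _ ⟨x, rfl⟩
    rw [← hset]
    exact h x

theorem AllLeavesDense.noProperMinimalSet {F : Setoid X} (hF : AllLeavesDense F) :
    NoProperMinimalSet F := by
  rintro S ⟨⟨⟨x, hx⟩, hcl, hsat⟩, -⟩
  have hsub : {y | F x y} ⊆ S := fun y hy => isSaturated_iff.1 hsat x y hy hx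
  exact univ_subset_iff.1
    ((allLeavesDense_iff.1 hF x).closure_eq ▸ closure_minimal hsub hcl)

/-- In a compact space, every nonempty closed saturated set contains a minimal set. -/
theorem exists_isMinimalSet_subset [CompactSpace X] {F : Setoid X} {S : Set X}
    (hne : S.Nonempty) (hcl : IsClosed S) (hsat : IsSaturated F S) :
    ∃ T ⊆ S, IsMinimalSet F T := by
  refine zorn_superset_nonempty {T : Set X | T.Nonempty ∧ IsClosed T ∧ IsSaturated F T}
    (fun c hc hchain hcne => ⟨⋂₀ c, ⟨?_, ?_, ?_⟩, fun s hs => sInter_subset_of_mem hs⟩) S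
    ⟨hne, hcl, hsat⟩
  · have := hcne.to_subtype
    exact IsCompact.nonempty_sInter_of_directed_nonempty_isCompact_isClosed
      (fun A hA B hB => (hchain.total hA hB).elim (fun h => ⟨A, hA, Subset.rfl, h⟩)
        fun h => ⟨B, hB, h, Subset.rfl⟩) (fun T hT => (hc hT).1) (fun T hT => (hc hT).2.1.isCompact)
      fun T hT => (hc hT).2.1
  · exact isClosed_sInter fun T hT => (hc hT).2.1
  · exact isSaturated_iff.2 fun x y hxy hx T hT =>
      isSaturated_iff.1 (hc hT).2.2 x y hxy (hx T hT)

/-- By compactness each leaf closure contains a minimal set, which must be the whole space. -/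
theorem NoProperMinimalSet.allLeavesDense [CompactSpace X] {F : Setoid X}
    (hF : NoProperMinimalSet F) (hsat : ∀ x, IsSaturated F (closure {y | F x y})) :
    AllLeavesDense F := by
  refine allLeavesDense_iff.2 fun x => ?_
  obtain ⟨T, hT, hmin⟩ := exists_isMinimalSet_subset
    (⟨x, subset_closure (F.refl x)⟩ : (closure {y | F x y}).Nonempty) isClosed_closure (hsat x)
  rw [hF T hmin] at hT
  exact fun y => hT (mem_univ y)

end Leaves

theorem isSaturated_closure_leaf {G : Subgroup (Diff m r M)} (hG : IsotopicallyConnected G)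
    (x : M) : IsSaturated (foliation G) (closure {y | foliation G x y}) := by
  refine isSaturated_iff.2 fun y z hyz hy => ?_
  obtain ⟨g, hg, rfl⟩ := (foliation_iff_of_isotopicallyConnected hG).1 hyz
  exact map_mem_closure g.continuous hy fun w hw =>
    (foliation G).trans hw ((foliation_iff_of_isotopicallyConnected hG).2 ⟨g, hg, rfl⟩)

/-! ### Passage from diffeomorphism groups to abstract actions. -/

noncomputable instance : MulAction (Diff m r M) M where
  smul g x := g x
  one_smul _ := rfl
  mul_smul _ _ _ := rfl

instance : FaithfulSMul (Diff m r M) M := ⟨fun h => Diffeomorph.ext h⟩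

instance : ContinuousConstSMul (Diff m r M) M := ⟨fun g => g.continuous⟩

instance (G : Subgroup (Diff m r M)) : ContinuousConstSMul G M :=
  ⟨fun g => (g : Diff m r M).continuous⟩

instance (G : Subgroup (Diff m r M)) : FaithfulSMul G M :=
  ⟨fun h => Subtype.ext (Diffeomorph.ext h)⟩

theorem Factorizable.fragmentable {G : Subgroup (Diff m r M)} (hG : Factorizable G) :
    FragmentedAction.Fragmentable G M := by
  intro 𝒰 ho hc
  refine eq_top_iff.2 ?_
  rintro ⟨g, hg⟩ -
  obtain ⟨l, hl, hlU⟩ := hG 𝒰 ho hc g hg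
  have key : ∀ h ∈ l, h ∈ (Subgroup.closure
      {g : G | ∃ U ∈ 𝒰, g ∈ FragmentedAction.rigidStabilizer G U}).map G.subtype := by
    intro h hh
    obtain ⟨U, hU, f, -, hfS, rfl⟩ := hlU h hh
    obtain ⟨hfG, -, hsupp⟩ := hfS 1
    refine ⟨⟨f 1, hfG⟩, Subgroup.subset_closure ⟨U, hU, ?_⟩, rfl⟩
    refine FragmentedAction.mem_rigidStabilizer.2 fun x hx => ?_
    by_contra hne
    exact hx (hsupp (subset_closure hne))
  obtain ⟨g', hg', e⟩ := hl ▸ list_prod_mem key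
  rwa [show (⟨g, hg⟩ : G) = g' from Subtype.ext e.symm]

end DiffGroups

end

theorem theorem1p1 {m : ℕ} {M : Type*} [TopologicalSpace M] [T2Space M] [ParacompactSpace M]
    [Nonempty M] [ChartedSpace (EuclideanSpace ℝ (Fin m)) M] [IsManifold (𝓡 m) ∞ M]
    (r : ℕ∞) (hr : 1 ≤ r) (G : Subgroup (DiffGroups.Diff m r M))
    (hG : (G : Set (DiffGroups.Diff m r M)) ⊆ DiffGroups.diffCompactZero m r M)
    (hconn : DiffGroups.IsotopicallyConnected G) (hfix : DiffGroups.NonFixing G)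
    (hfact : DiffGroups.Factorizable G) :
    (IsSimpleGroup ↥⁅G, G⁆ ↔ DiffGroups.AllLeavesDense (DiffGroups.foliation ⁅G, G⁆)) ∧
    (IsSimpleGroup ↥⁅G, G⁆ → DiffGroups.NoProperMinimalSet (DiffGroups.foliation ⁅G, G⁆)) ∧
    (CompactSpace M →
      (IsSimpleGroup ↥⁅G, G⁆ ↔
        DiffGroups.NoProperMinimalSet (DiffGroups.foliation ⁅G, G⁆))) := by
  have hD := hconn.commutator hr
  have hmap : (commutator G).map G.subtype = ⁅G, G⁆ := G.map_subtype_commutator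
  -- The abstract theorem concerns a subgroup of the group `G` itself, whereas `⁅G, G⁆` lives in the
  -- ambient diffeomorphism group.
  have e : commutator G ≃* ↥⁅G, G⁆ :=
    ((commutator G).equivMapOfInjective G.subtype G.subtype_injective).trans
      (MulEquiv.subgroupCongr hmap)
  have hsimple : IsSimpleGroup ↥⁅G, G⁆ ↔ IsSimpleGroup (commutator G) :=
    ⟨fun _ => e.isSimpleGroup, fun _ => e.symm.isSimpleGroup⟩
  have hmove : FragmentedAction.MovesAllPoints G M := fun x => by
    obtain ⟨g, hg, hgx⟩ := hfix x
    exact ⟨⟨g, hg⟩, hgx⟩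
  have hleaf : ∀ x : M, {y | DiffGroups.foliation ⁅G, G⁆ x y} =
      {y | ∃ d ∈ commutator G, d • x = y} := by
    intro x
    ext y
    refine (DiffGroups.foliation_iff_of_isotopicallyConnected hD).trans ?_
    rw [← hmap]
    constructor
    · rintro ⟨_, ⟨d, hd, rfl⟩, rfl⟩
      exact ⟨d, hd, rfl⟩
    · rintro ⟨d, hd, rfl⟩
      exact ⟨_, ⟨d, hd, rfl⟩, rfl⟩
  have hmain : IsSimpleGroup ↥⁅G, G⁆ ↔
      DiffGroups.AllLeavesDense (DiffGroups.foliation ⁅G, G⁆) := by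
    rw [hsimple, FragmentedAction.isSimpleGroup_commutator_iff hfact.fragmentable hmove,
      DiffGroups.allLeavesDense_iff]
    simp only [hleaf]
  exact ⟨hmain, fun h => (hmain.1 h).noProperMinimalSet, fun _ =>
    ⟨fun h => (hmain.1 h).noProperMinimalSet,
      fun h => hmain.2 (h.allLeavesDense (DiffGroups.isSaturated_closure_leaf hD))⟩⟩
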